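/- Let $F$ be a field of characteristic zero, let $m\ge 1$ and $t=2m+1$. Let $R=UT_t(F)$ be the associative algebra of upper triangular $t\times t$ matrices over $F$ with the orthogonal involution $\circ$, the reflection along the secondary diagonal, $e_{ij}^\circ=e_{t+1-j,\,t+1-i}$. Let $L=(S(t),\circ)$ be the Lie superalgebra $$L=\left\{\begin{pmatrix}x&y\\ z&-x^\circ\end{pmatrix}\ \middle|\ x,y,z\in R,\ y^\circ=y,\ z^\circ=-z\right\}\subseteq M_2(R),$$ with even component $L_0=\{y=z=0\}$, odd component $L_1=\{x=0\}$ and, for homogeneous $a,b$, the product $[a,b]=ab-(-1)^{|a||b|}ba$. Let $F\{X,Y\}$ be the free nonassociative algebra on infinite sets $X=\{x_1,x_2,\dots\}$ and $Y=\{y_1,y_2,\dots\}$ of even and odd generators, let $Id^{gr}(L)$ be the set of its elements which vanish under all substitutions of elements of $L_0$ for the even generators and of elements of $L_1$ for the odd ones, and let $P_{k,l}\subset F\{X,Y\}$ be the space of multilinear polynomials in $x_1,\dots,x_k,y_1,\dots,y_l$. Put $$c_{k,l}(L)=\dim\frac{P_{k,l}}{P_{k,l}\cap Id^{gr}(L)},\qquad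 c_n^{gr}(L)=\sum_{k=0}^n\binom nk c_{k,n-k}(L).$$ Then the lower graded PI-exponent of $L$ satisfies $$\underline{exp}^{gr}(L)=\liminf_{n\to\infty}\sqrt[n]{c_n^{gr}(L)}\ \ge\ 2t-1=4m+1.$$ -/

import Mathlib

open scoped ENNReal

/-! ### Graded identities, graded codimensions and the lower graded exponent

`F{X,Y}` is the free nonassociative algebra on the even letters `x₀, x₁, …` (the `Sum.inl i`) and
the odd letters `y₀, y₁, …` (the `Sum.inr j`).  A `ℤ₂`-grading `A = A₀ ⊕ A₁` of a (not necessarily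
associative) algebra `A` enters through its two homogeneous components `A₀` and `A₁`. -/

/-- The free nonassociative algebra `F{X,Y}` on countably many even and odd generators. -/
abbrev FreeXY (F : Type*) [Field F] : Type _ := FreeNonUnitalNonAssocAlgebra F (ℕ ⊕ ℕ)

/-- The multiset of letters occurring in a nonassociative word. -/
def magmaLetters {α : Type*} : FreeMagma α → Multiset α
  | FreeMagma.of a => {a}
  | FreeMagma.mul u v => magmaLetters u + magmaLetters v

/-- The letters `x₀, …, x_{k-1}, y₀, …, y_{l-1}`, each with multiplicity one. -/
def multilinearLetters (k l : ℕ) : Multiset (ℕ ⊕ ℕ) :=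
  (Multiset.range k).map Sum.inl + (Multiset.range l).map Sum.inr

/-- `P_{k,l}`: the space of multilinear polynomials in `x₀, …, x_{k-1}, y₀, …, y_{l-1}`, spanned by
the words in which each of these letters occurs exactly once and no other letter occurs. -/
noncomputable def multilinearPart (F : Type*) [Field F] (k l : ℕ) : Submodule F (FreeXY F) :=
  Submodule.span F
    {f | ∃ w : FreeMagma (ℕ ⊕ ℕ),
      magmaLetters w = multilinearLetters k l ∧ f = MonoidAlgebra.single w 1}

/-- `Id^gr(A)`: the polynomials vanishing under all substitutions of elements of `A₀` for the even
letters and of elements of `A₁` for the odd letters. -/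
noncomputable def gradedIdentities (F : Type*) [Field F] {A : Type*} [NonUnitalNonAssocRing A]
    [Module F A] [IsScalarTower F A A] [SMulCommClass F A A] (A₀ A₁ : Submodule F A) :
    Submodule F (FreeXY F) where
  carrier := {f | ∀ (a : ℕ → A₀) (b : ℕ → A₁),
    FreeNonUnitalNonAssocAlgebra.lift F
      (Sum.elim (fun i => (a i : A)) (fun j => (b j : A))) f = 0}
  add_mem' := fun hf hg a b => by rw [map_add, hf a b, hg a b, add_zero]
  zero_mem' := fun a b => map_zero _
  smul_mem' := fun c f hf a b => by rw [map_smul, hf a b, smul_zero]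

/-- The partial graded codimension `c_{k,l}(A) = dim P_{k,l} / (P_{k,l} ∩ Id^gr(A))`. -/
noncomputable def partialCodim (F : Type*) [Field F] {A : Type*} [NonUnitalNonAssocRing A]
    [Module F A] [IsScalarTower F A A] [SMulCommClass F A A] (A₀ A₁ : Submodule F A)
    (k l : ℕ) : ℕ :=
  Module.finrank F
    (multilinearPart F k l ⧸ (gradedIdentities F A₀ A₁).comap (multilinearPart F k l).subtype)

/-- The graded codimension `c_n^gr(A) = ∑_{k=0}^n (n choose k) c_{k,n-k}(A)`. -/
noncomputable def gradedCodim (F : Type*) [Field F] {A : Type*} [NonUnitalNonAssocRing A]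
    [Module F A] [IsScalarTower F A A] [SMulCommClass F A A] (A₀ A₁ : Submodule F A)
    (n : ℕ) : ℕ :=
  ∑ k ∈ Finset.range (n + 1), n.choose k * partialCodim F A₀ A₁ k (n - k)

/-- The lower graded exponent: the lower limit of the `n`-th roots of `c_n^gr(A)`, taken in
`[0, ∞]`, where it exists for every sequence. -/
noncomputable def lowerGradedExp (F : Type*) [Field F] {A : Type*} [NonUnitalNonAssocRing A]
    [Module F A] [IsScalarTower F A A] [SMulCommClass F A A] (A₀ A₁ : Submodule F A) : ℝ≥0∞ :=
  Filter.liminf (fun n : ℕ => (gradedCodim F A₀ A₁ n : ℝ≥0∞) ^ (1 / (n : ℝ))) Filter.atTop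

/-! ### The Lie superalgebra attached to an associative algebra with involution -/

/-- An involution of an associative `F`-algebra: a linear anti-automorphism of order at most two. -/
structure AlgInvolution (F R : Type*) [Field F] [Ring R] [Algebra F R] where
  /-- the underlying linear map -/
  toLin : R →ₗ[F] R
  map_mul' : ∀ x y, toLin (x * y) = toLin y * toLin x
  invol' : ∀ x, toLin (toLin x) = x

/-- The even (block diagonal) component of an element of `Q = M₂(R)`. -/
def evenPart {R : Type*} [Ring R] (M : Matrix (Fin 2) (Fin 2) R) : Matrix (Fin 2) (Fin 2) R :=
  !![M 0 0, 0; 0, M 1 1]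

/-- The odd (block off-diagonal) component of an element of `Q = M₂(R)`. -/
def oddPart {R : Type*} [Ring R] (M : Matrix (Fin 2) (Fin 2) R) : Matrix (Fin 2) (Fin 2) R :=
  !![0, M 0 1; M 1 0, 0]

/-- The supercommutator on `Q = M₂(R)`: the biadditive map which on homogeneous elements is
`[x, y] = x y - (-1)^{|x||y|} y x`. -/
def superBracket {R : Type*} [Ring R] (M N : Matrix (Fin 2) (Fin 2) R) :
    Matrix (Fin 2) (Fin 2) R :=
  (evenPart M * evenPart N - evenPart N * evenPart M) +
  (evenPart M * oddPart N - oddPart N * evenPart M) +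
  (oddPart M * evenPart N - evenPart N * oddPart M) +
  (oddPart M * oddPart N + oddPart N * oddPart M)

section Bilinearity

variable {R : Type*} [Ring R] (M M' N N' : Matrix (Fin 2) (Fin 2) R)

theorem evenPart_add : evenPart (M + N) = evenPart M + evenPart N := by
  ext i j; fin_cases i <;> fin_cases j <;> simp [evenPart]

theorem oddPart_add : oddPart (M + N) = oddPart M + oddPart N := by
  ext i j; fin_cases i <;> fin_cases j <;> simp [oddPart]

theorem superBracket_add_left :
    superBracket (M + M') N = superBracket M N + superBracket M' N := by
  simp only [superBracket, evenPart_add, oddPart_add]; noncomm_ring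

theorem superBracket_add_right :
    superBracket M (N + N') = superBracket M N + superBracket M N' := by
  simp only [superBracket, evenPart_add, oddPart_add]; noncomm_ring

variable {F : Type*} [Field F] [Algebra F R] (c : F)

theorem evenPart_smul : evenPart (c • M) = c • evenPart M := by
  ext i j; fin_cases i <;> fin_cases j <;> simp [evenPart]

theorem oddPart_smul : oddPart (c • M) = c • oddPart M := by
  ext i j; fin_cases i <;> fin_cases j <;> simp [oddPart]

theorem superBracket_smul_left : superBracket (c • M) N = c • superBracket M N := by
  simp only [superBracket, evenPart_smul, oddPart_smul, Matrix.smul_mul, Matrix.mul_smul,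
    smul_add, smul_sub]

theorem superBracket_smul_right : superBracket M (c • N) = c • superBracket M N := by
  simp only [superBracket, evenPart_smul, oddPart_smul, Matrix.smul_mul, Matrix.mul_smul,
    smul_add, smul_sub]

end Bilinearity

section SuperOfInvolution

variable {F R : Type*} [Field F] [Ring R] [Algebra F R]

/-- The subspace of all `!![x, y; z, -x^*]` in `M₂(R)` with `y^* = y` and `z^* = -z`. -/
def superSubmodule (σ : AlgInvolution F R) : Submodule F (Matrix (Fin 2) (Fin 2) R) where
  carrier := {M | M 1 1 = -σ.toLin (M 0 0) ∧ σ.toLin (M 0 1) = M 0 1 ∧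
    σ.toLin (M 1 0) = -M 1 0}
  add_mem' := by
    rintro M N ⟨h1, h2, h3⟩ ⟨k1, k2, k3⟩
    refine ⟨?_, ?_, ?_⟩ <;> simp only [Matrix.add_apply, map_add, *] <;> abel
  zero_mem' := by simp
  smul_mem' := by
    rintro c M ⟨h1, h2, h3⟩
    refine ⟨?_, ?_, ?_⟩ <;> simp only [Matrix.smul_apply, map_smul, smul_neg, *]

theorem superBracket_mem (σ : AlgInvolution F R) {M N : Matrix (Fin 2) (Fin 2) R}
    (hM : M ∈ superSubmodule σ) (hN : N ∈ superSubmodule σ) :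
    superBracket M N ∈ superSubmodule σ := by
  obtain ⟨h1, h2, h3⟩ := hM
  obtain ⟨k1, k2, k3⟩ := hN
  refine ⟨?_, ?_, ?_⟩ <;>
    simp only [superBracket, evenPart, oddPart, Matrix.add_apply, Matrix.sub_apply,
      Matrix.mul_apply, Fin.sum_univ_two, Matrix.of_apply, Matrix.cons_val', Matrix.cons_val_zero,
      Matrix.cons_val_one, Matrix.cons_val_fin_one, map_add, map_sub, map_neg, map_zero,
      σ.map_mul', σ.invol', h1, h2, h3, k1, k2, k3] <;>
    noncomm_ring

/-- The Lie superalgebra of all `!![x, y; z, -x^*]` with `x ∈ R`, `y ∈ R⁺`, `z ∈ R⁻`; its product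
is the supercommutator. -/
def SuperOf (σ : AlgInvolution F R) : Type _ := superSubmodule σ

namespace SuperOf

variable (σ : AlgInvolution F R)

instance : AddCommGroup (SuperOf σ) := inferInstanceAs (AddCommGroup (superSubmodule σ))

instance : Module F (SuperOf σ) := inferInstanceAs (Module F (superSubmodule σ))

/-- The inclusion into `M₂(R)`. -/
def val : SuperOf σ →ₗ[F] Matrix (Fin 2) (Fin 2) R := (superSubmodule σ).subtype

theorem val_injective : Function.Injective (val σ) := Subtype.val_injective

instance : Mul (SuperOf σ) :=
  ⟨fun a b => ⟨superBracket a.1 b.1, superBracket_mem σ a.2 b.2⟩⟩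

theorem val_mul (a b : SuperOf σ) : val σ (a * b) = superBracket (val σ a) (val σ b) := rfl

instance : NonUnitalNonAssocRing (SuperOf σ) :=
  { (inferInstance : AddCommGroup (SuperOf σ)), (inferInstance : Mul (SuperOf σ)) with
    left_distrib := fun a b c => val_injective σ (by
      simp only [map_add, val_mul, superBracket_add_right])
    right_distrib := fun a b c => val_injective σ (by
      simp only [map_add, val_mul, superBracket_add_left])
    zero_mul := fun a => val_injective σ (by
      rw [val_mul, map_zero]; simpa using superBracket_add_left 0 0 (val σ a))
    mul_zero := fun a => val_injective σ (by
      rw [val_mul, map_zero]; simpa using superBracket_add_right (val σ a) 0 0) }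

instance : IsScalarTower F (SuperOf σ) (SuperOf σ) :=
  ⟨fun c a b => val_injective σ (by
    simp only [smul_eq_mul, map_smul, val_mul, superBracket_smul_left])⟩

instance : SMulCommClass F (SuperOf σ) (SuperOf σ) :=
  ⟨fun c a b => val_injective σ (by
    simp only [smul_eq_mul, map_smul, val_mul, superBracket_smul_right])⟩

/-- The even component `L₀`: the elements `!![x, 0; 0, -x^*]`. -/
def even : Submodule F (SuperOf σ) where
  carrier := {a | val σ a 0 1 = 0 ∧ val σ a 1 0 = 0}
  add_mem' := by rintro a b ⟨h1, h2⟩ ⟨k1, k2⟩; simp [h1, h2, k1, k2]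
  zero_mem' := by simp
  smul_mem' := by rintro c a ⟨h1, h2⟩; simp [h1, h2]

/-- The odd component `L₁`: the elements `!![0, y; z, 0]`. -/
def odd : Submodule F (SuperOf σ) where
  carrier := {a | val σ a 0 0 = 0 ∧ val σ a 1 1 = 0}
  add_mem' := by rintro a b ⟨h1, h2⟩ ⟨k1, k2⟩; simp [h1, h2, k1, k2]
  zero_mem' := by simp
  smul_mem' := by rintro c a ⟨h1, h2⟩; simp [h1, h2]

end SuperOf

end SuperOfInvolution

/-! ### The Lie superalgebra `(S(t), ∘)` -/

/-- `UT_t(F)`: the associative algebra of upper triangular `t × t` matrices over `F`. -/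
abbrev UT (F : Type*) [Field F] (t : ℕ) : Subalgebra F (Matrix (Fin t) (Fin t) F) :=
  Matrix.blockTriangularSubalgebra F F (id : Fin t → Fin t)

/-- The reflection of a square matrix along the secondary diagonal. -/
def secondaryTranspose {F : Type*} {t : ℕ} (X : Matrix (Fin t) (Fin t) F) :
    Matrix (Fin t) (Fin t) F :=
  Matrix.of fun i j => X (Fin.rev j) (Fin.rev i)

theorem secondaryTranspose_mul {F : Type*} [Field F] {t : ℕ} (X Y : Matrix (Fin t) (Fin t) F) :
    secondaryTranspose (X * Y) = secondaryTranspose Y * secondaryTranspose X := by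
  ext i j
  simp only [secondaryTranspose, Matrix.of_apply, Matrix.mul_apply]
  exact Fintype.sum_equiv Fin.revPerm _ _ (fun k => by simp [mul_comm])

theorem secondaryTranspose_invol {F : Type*} {t : ℕ} (X : Matrix (Fin t) (Fin t) F) :
    secondaryTranspose (secondaryTranspose X) = X := by
  ext i j; simp [secondaryTranspose]

theorem secondaryTranspose_mem {F : Type*} [Field F] {t : ℕ} (X : UT F t) :
    secondaryTranspose X.1 ∈ UT F t :=
  fun i j hij => X.2 (show Fin.rev i < Fin.rev j from Fin.rev_lt_rev.mpr hij)

/-- The orthogonal involution `∘` of `UT_t(F)`: the reflection along the secondary diagonal.  On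
matrix units (indexed from `1`) it is `e_{ij}^∘ = e_{t+1-j, t+1-i}`. -/
def orthogonalInvolution (F : Type*) [Field F] (t : ℕ) : AlgInvolution F (UT F t) where
  toLin :=
    { toFun := fun X => ⟨secondaryTranspose X.1, secondaryTranspose_mem X⟩
      map_add' := fun _ _ => rfl
      map_smul' := fun _ _ => rfl }
  map_mul' := fun X Y => Subtype.ext (secondaryTranspose_mul X.1 Y.1)
  invol' := fun X => Subtype.ext (secondaryTranspose_invol X.1)

/-- The Lie superalgebra `(S(t), ∘)`. -/
abbrev SOrth (F : Type*) [Field F] (t : ℕ) : Type _ := SuperOf (orthogonalInvolution F t)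

/-! Multilinear words are independent modulo the graded identities as soon as there is a family of
graded evaluations whose value matrix is diagonal with nonzero diagonal (`card_le_partialCodim`).
The words are all obtained from one left-normed template by renaming letters.

The template follows a walk by right multiplication. At each level `j` stands the matrix unit
joining the two indices at distance `j` from the middle. It is symmetric, so it gives an odd element
`oddUnit j`; it also gives an even element `evenUnit j`. Two jumps lead from `oddUnit j` to `oddUnit
(j+1)`. At a level `j ≥ 1` one diagonal even element sees only the odd unit, another only the even
unit, one diagonal odd element leads from odd to even and one leads back. A cycle through these four
reproduces the odd unit up to a nonzero scalar, and any wrong diagonal element of the same parity at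
any place gives zero. Level 0 is the middle index, where only one even element is used. Altogether
there are `2m+1` even and `2m` odd diagonal elements, hence `4m+1` types.

Giving each type `q` slots and permuting the slots within each parity, the word survives an
evaluation exactly when every slot receives its own type (`templateCoeff_ne_zero_iff`). So the
partial codimension is at least the product of the multinomials `((2m+1)q)!/q!^(2m+1)` and
`(2mq)!/q!^(2m)` (`card_mul_card_le_partialCodim`). The binomial coefficient in the graded
codimension merges the two into `((4m+1)q)!/q!^(4m+1)`, which is `(4m+1)^n` up to a polynomial
factor in `n`. Such factors disappear under the `n`-th root (`le_liminf_rpow_one_div`). -/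

/-! ### Words and a lower bound for partial codimensions -/

section Words

variable {α : Type*}

/-- The left-normed word `(⋯((a b₁) b₂)⋯) b_n`. -/
def leftNormedWord (a : α) (l : List α) : FreeMagma α :=
  l.foldl (fun w b => w * FreeMagma.of b) (FreeMagma.of a)

theorem magmaLetters_foldl (l : List α) (w : FreeMagma α) :
    magmaLetters (l.foldl (fun w b => w * FreeMagma.of b) w) = magmaLetters w + (l : Multiset α) := by
  induction l generalizing w with
  | nil => simp
  | cons b l ih =>
    rw [List.foldl_cons, ih]
    change magmaLetters w + {b} + (l : Multiset α) = _
    rw [add_assoc, Multiset.singleton_add, Multiset.cons_coe]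

theorem magmaLetters_leftNormedWord (a : α) (l : List α) :
    magmaLetters (leftNormedWord a l) = ((a :: l : List α) : Multiset α) := by
  rw [leftNormedWord, magmaLetters_foldl]
  change {a} + (l : Multiset α) = _
  rw [Multiset.singleton_add, Multiset.cons_coe]

theorem lift_foldl_word {A : Type*} [Mul A] (f : α → A) (l : List α) (w : FreeMagma α) :
    FreeMagma.lift f (l.foldl (fun w b => w * FreeMagma.of b) w) =
      l.foldl (fun v b => v * f b) (FreeMagma.lift f w) := by
  induction l generalizing w with
  | nil => rfl
  | cons b l ih => rw [List.foldl_cons, ih, map_mul, FreeMagma.lift_of, List.foldl_cons]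

theorem lift_leftNormedWord {A : Type*} [Mul A] (f : α → A) (a : α) (l : List α) :
    FreeMagma.lift f (leftNormedWord a l) = l.foldl (fun v b => v * f b) (f a) := by
  rw [leftNormedWord, lift_foldl_word, FreeMagma.lift_of]

theorem magmaLetters_ne_zero (w : FreeMagma α) : magmaLetters w ≠ 0 := by
  induction w with
  | ih1 a => exact Multiset.singleton_ne_zero a
  | ih2 u v hu hv =>
    change magmaLetters u + magmaLetters v ≠ 0
    simp [hu]

/-- A product splits its letters between two factors, neither of which is empty, so both factors
have strictly smaller multisets and induction applies. -/
theorem finite_setOf_magmaLetters_eq (M : Multiset α) :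
    {w : FreeMagma α | magmaLetters w = M}.Finite := by
  classical
  induction M using Multiset.strongInductionOn with
  | ih M ih =>
    have hfin : (⋃ N ∈ {N | N < M}, {w : FreeMagma α | magmaLetters w = N}).Finite := by
      refine Set.Finite.biUnion ?_ fun N hN => ih N hN
      exact (Multiset.finite_toSet M.powerset).subset fun N hN =>
        Multiset.mem_powerset.2 (le_of_lt hN)
    refine (((Multiset.finite_toSet M).image FreeMagma.of).union
      ((hfin.prod hfin).image fun p => p.1 * p.2)).subset ?_
    rintro w rfl
    cases w with
    | of a => exact Or.inl ⟨a, Multiset.mem_singleton_self a, rfl⟩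
    | mul u v =>
      refine Or.inr ⟨(u, v), ⟨?_, ?_⟩, rfl⟩ <;> simp only [Set.mem_iUnion, Set.mem_ofPred_eq]
      · exact ⟨magmaLetters u, lt_add_of_pos_right _
          (pos_iff_ne_zero.2 (magmaLetters_ne_zero v)), rfl⟩
      · exact ⟨magmaLetters v, lt_add_of_pos_left _
          (pos_iff_ne_zero.2 (magmaLetters_ne_zero u)), rfl⟩

end Words

/-! ### Independence of words modulo the graded identities -/

section Codim

variable {F : Type*} [Field F]

/-- Needed because `Module.finrank` is 0 in infinite dimension, where independent vectors would
bound nothing. -/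
instance finiteDimensional_multilinearPart (k l : ℕ) :
    FiniteDimensional F (multilinearPart F k l) := by
  refine FiniteDimensional.span_of_finite F ?_
  refine ((finite_setOf_magmaLetters_eq (multilinearLetters k l)).image
    fun w => (MonoidAlgebra.single w 1 : FreeXY F)).subset ?_
  rintro f ⟨w, hw, rfl⟩
  exact ⟨w, hw, rfl⟩

variable {A : Type*} [NonUnitalNonAssocRing A] [Module F A] [IsScalarTower F A A]
  [SMulCommClass F A A]

theorem lift_single_one {α : Type*} (f : α → A) (w : FreeMagma α) :
    FreeNonUnitalNonAssocAlgebra.lift F f (MonoidAlgebra.single w 1) = FreeMagma.lift f w := by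
  simp [FreeNonUnitalNonAssocAlgebra.lift, MonoidAlgebra.liftMagma]

/-- A family of multilinear words with a dual family of graded evaluations bounds the partial
codimension from below. -/
theorem card_le_partialCodim (A₀ A₁ : Submodule F A) {k l : ℕ} {ι : Type*} [Fintype ι]
    (w : ι → FreeMagma (ℕ ⊕ ℕ)) (hw : ∀ i, magmaLetters (w i) = multilinearLetters k l)
    (a : ι → ℕ → A₀) (b : ι → ℕ → A₁)
    (hself : ∀ i, FreeMagma.lift
      (Sum.elim (fun n => (a i n : A)) (fun n => (b i n : A))) (w i) ≠ 0)
    (hne : ∀ i j, j ≠ i → FreeMagma.lift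
      (Sum.elim (fun n => (a i n : A)) (fun n => (b i n : A))) (w j) = 0) :
    Fintype.card ι ≤ partialCodim F A₀ A₁ k l := by
  let f : ι → multilinearPart F k l :=
    fun i => ⟨MonoidAlgebra.single (w i) 1, Submodule.subset_span ⟨w i, hw i, rfl⟩⟩
  let I := (gradedIdentities F A₀ A₁).comap (multilinearPart F k l).subtype
  have hli : LinearIndependent F fun i => I.mkQ (f i) := by
    rw [Fintype.linearIndependent_iff]
    intro g hg i
    simp only [← map_smul, ← map_sum] at hg
    have hmem : ∑ i, g i • f i ∈ I := (Submodule.Quotient.mk_eq_zero I).1 hg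
    have h0 := hmem (a i) (b i)
    -- Evaluation `i` kills every word of the relation except word `i`, which isolates the
    -- coefficient `g i`.
    rw [map_sum, map_sum] at h0
    simp only [map_smul, Submodule.subtype_apply, f, lift_single_one] at h0
    rw [Finset.sum_eq_single i (fun j _ hj => by rw [hne i j hj, smul_zero]) (by simp)] at h0
    exact (smul_eq_zero.1 h0).resolve_right (hself i)
  exact hli.fintype_card_le_finrank

end Codim

/-! ### Counting -/

section Counting

/-- The functions `T × Fin q → T` with all fibres of size `q`. -/
abbrev EquifiberedMaps (T : Type*) (q : ℕ) : Set (T × Fin q → T) :=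
  Set.range fun g : Equiv.Perm (T × Fin q) => Prod.fst ∘ g

open Nat in
-- Orbit counting: the permutations `g` with a given `Prod.fst ∘ g` form a coset of the stabilizer
-- of `Prod.fst`, which permutes each of the fibres of size `q` separately.
theorem factorial_le_card_equifiberedMaps (T : Type*) [Fintype T] [DecidableEq T] (q : ℕ) :
    (Fintype.card T * q)! ≤
      Nat.card (EquifiberedMaps T q) * q ! ^ Fintype.card T := by
  classical
  have hstab : Fintype.card {g : Equiv.Perm (T × Fin q) // (Prod.fst ∘ g : T × Fin q → T) = Prod.fst}
      = q ! ^ Fintype.card T := by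
    rw [DomMulAct.stabilizer_card]
    have h : ∀ i : T, Fintype.card {a : T × Fin q // a.1 = i} = q := fun i => by
      rw [Fintype.card_congr (β := Fin q) ⟨fun a => a.1.2, fun c => ⟨(i, c), rfl⟩,
        fun ⟨⟨_, _⟩, h⟩ => by cases h; rfl, fun _ => rfl⟩, Fintype.card_fin]
    simp [h]
  have hcard := Finset.card_le_mul_card_image (s := Finset.univ)
    (f := fun g : Equiv.Perm (T × Fin q) => (Prod.fst ∘ g : T × Fin q → T)) (q ! ^ Fintype.card T) ?_
  · rw [Finset.card_univ, Fintype.card_perm, Fintype.card_prod, Fintype.card_fin] at hcard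
    refine hcard.trans (le_of_eq ?_)
    rw [mul_comm, Nat.card_eq_fintype_card, ← Set.toFinset_card, Set.toFinset_range]
  · rintro s -
    by_cases hs : ∃ g₀ : Equiv.Perm (T × Fin q), (Prod.fst ∘ g₀ : T × Fin q → T) = s
    · obtain ⟨g₀, rfl⟩ := hs
      rw [← hstab, Fintype.card_subtype]
      -- Dividing by a fixed member of the fibre moves the fibre into the stabilizer.
      refine Finset.card_le_card_of_injOn (fun g => g * g₀⁻¹) ?_ (by intro g _ g' _ h; simpa using h)
      intro g hg
      simp only [Finset.coe_filter, Finset.mem_univ, true_and, Set.mem_ofPred_eq] at hg ⊢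
      ext x
      have := congrFun hg (g₀⁻¹ x)
      simpa using this
    · rw [Finset.card_eq_zero.2]
      · exact Nat.zero_le _
      · rw [Finset.filter_eq_empty_iff]
        exact fun g _ hg => hs ⟨g, hg⟩

theorem choose_le_choose_add (a b c d : ℕ) (h : d ≤ c) :
    a.choose b ≤ (a + c).choose (b + d) := by
  induction d generalizing c with
  | zero => exact Nat.choose_le_choose b (Nat.le_add_right a c)
  | succ d ih =>
    obtain ⟨c, rfl⟩ : ∃ e, c = e + 1 := ⟨c - 1, by omega⟩
    refine (ih c (by omega)).trans ?_
    rw [← add_assoc, ← add_assoc, Nat.choose_succ_succ]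
    exact Nat.le_add_right _ _

open Nat in
-- A replacement for Stirling's formula: the left side is the product of the `(p * i) ^ p` for `1 ≤
-- i ≤ q`, and each of these is at most the product of the `p` integers following `p * i`. The
-- factor `(q + 1) ^ p` is slack.
theorem pow_mul_factorial_pow_le (p q : ℕ) :
    p ^ (p * q) * q ! ^ p ≤ (p * (q + 1))! * (q + 1) ^ p := by
  induction q with
  | zero => simpa using Nat.succ_le_of_lt (Nat.factorial_pos p)
  | succ q ih =>
    have h1 : (p * (q + 1))! * (p * (q + 1)) ^ p ≤ (p * (q + 1 + 1))! :=
      calc (p * (q + 1))! * (p * (q + 1)) ^ p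
          ≤ (p * (q + 1))! * (p * (q + 1) + 1) ^ p := by gcongr; omega
        _ ≤ (p * (q + 1) + p)! := Nat.factorial_mul_pow_le_factorial
        _ = _ := by rw [Nat.mul_add_one p (q + 1)]
    calc p ^ (p * (q + 1)) * (q + 1)! ^ p
        = (p ^ (p * q) * q ! ^ p) * (p * (q + 1)) ^ p := by
          rw [Nat.factorial_succ, mul_pow p (q + 1), mul_pow (q + 1), Nat.mul_add_one, pow_add]; ring
      _ ≤ ((p * (q + 1))! * (q + 1) ^ p) * (p * (q + 1)) ^ p := by gcongr
      _ = ((p * (q + 1))! * (p * (q + 1)) ^ p) * (q + 1) ^ p := by ring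
      _ ≤ (p * (q + 1 + 1))! * (q + 1) ^ p := by gcongr
      _ ≤ _ := by gcongr; omega

end Counting

/-! ### From polynomially corrected bounds to the exponent -/

section Growth

open Filter Topology in
/-- A sequence bounded from below by `p ^ n / (C n ^ d)` has exponent at least `p`. -/
theorem le_liminf_rpow_one_div {c : ℕ → ℕ} {p C d : ℕ} (hC : C ≠ 0)
    (h : ∀ᶠ n in atTop, p ^ n ≤ c n * (C * n ^ d)) :
    (p : ℝ≥0∞) ≤ liminf (fun n : ℕ => (c n : ℝ≥0∞) ^ (1 / (n : ℝ))) atTop := by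
  -- Both `C ^ (1/n)` and `n ^ (1/n)` tend to 1; the limit is taken in `ℝ` and carried to `ℝ≥0∞` by
  -- `ENNReal.ofReal`.
  have hlim : Tendsto (fun n : ℕ => ((p : ℝ) / ((C : ℝ) ^ (1 / (n : ℝ)) * ((n : ℝ) ^ (1 / (n : ℝ))) ^ d)))
      atTop (𝓝 ((p : ℝ) / (1 * 1 ^ d))) := by
    refine tendsto_const_nhds.div (Tendsto.mul ?_ (Tendsto.pow ?_ d)) (by simp)
    · have h0 : Tendsto (fun n : ℕ => 1 / (n : ℝ)) atTop (𝓝 0) := tendsto_one_div_atTop_nhds_zero_nat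
      have hC' : (C : ℝ) ≠ 0 := by exact_mod_cast hC
      simpa using (tendsto_const_nhds (x := (C : ℝ))).rpow h0 (Or.inl hC')
    · exact tendsto_rpow_div.comp tendsto_natCast_atTop_atTop
  have hlim' := ENNReal.tendsto_ofReal hlim
  simp only [one_pow, mul_one, div_one, ENNReal.ofReal_natCast] at hlim'
  rw [← hlim'.liminf_eq]
  refine liminf_le_liminf ?_
  filter_upwards [h, eventually_gt_atTop 0] with n hn hpos
  have hn0 : (0 : ℝ) < n := by exact_mod_cast hpos
  have hC0 : (0 : ℝ) < C := by exact_mod_cast Nat.pos_of_ne_zero hC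
  have hle : (p : ℝ) ^ n ≤ c n * (C * (n : ℝ) ^ d) := by exact_mod_cast hn
  have key : (p : ℝ) / ((C : ℝ) ^ (1 / (n : ℝ)) * ((n : ℝ) ^ (1 / (n : ℝ))) ^ d) ≤
      (c n : ℝ) ^ (1 / (n : ℝ)) := by
    rw [div_le_iff₀ (by positivity)]
    calc (p : ℝ) = ((p : ℝ) ^ n) ^ (1 / (n : ℝ)) := by
          rw [one_div, Real.pow_rpow_inv_natCast (Nat.cast_nonneg p) hpos.ne']
      _ ≤ (c n * (C * (n : ℝ) ^ d)) ^ (1 / (n : ℝ)) :=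
          Real.rpow_le_rpow (by positivity) hle (by positivity)
      _ = _ := by
          rw [Real.mul_rpow (by positivity) (by positivity),
            Real.mul_rpow (by positivity) (by positivity), Real.rpow_pow_comm hn0.le]
  calc ENNReal.ofReal _ ≤ ENNReal.ofReal ((c n : ℝ) ^ (1 / (n : ℝ))) := ENNReal.ofReal_le_ofReal key
    _ = _ := by
      rw [← ENNReal.ofReal_rpow_of_nonneg (Nat.cast_nonneg _) (by positivity),
        ENNReal.ofReal_natCast]

end Growth

/-! ### Products in the Lie superalgebra of an involution -/

namespace SuperOf

section Elements

variable {F R : Type*} [Field F] [Ring R] [Algebra F R] (σ : AlgInvolution F R)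

/-- The even element `!![x, 0; 0, -x^*]`. -/
def evenElt : R →ₗ[F] SuperOf σ where
  toFun x := ⟨!![x, 0; 0, -σ.toLin x], by simp [superSubmodule]⟩
  map_add' x y := Subtype.ext (by
    change !![_, _; _, _] = !![_, _; _, _] + !![_, _; _, _]
    ext i j; fin_cases i <;> fin_cases j <;> simp [add_comm])
  map_smul' c x := Subtype.ext (by
    change !![_, _; _, _] = c • !![_, _; _, _]
    ext i j; fin_cases i <;> fin_cases j <;> simp)

/-- The odd element `!![0, y + y^*; 0, 0]`. -/
def upperElt : R →ₗ[F] SuperOf σ where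
  toFun y := ⟨!![0, y + σ.toLin y; 0, 0], by simp [superSubmodule, σ.invol', add_comm]⟩
  map_add' x y := Subtype.ext (by
    change !![_, _; _, _] = !![_, _; _, _] + !![_, _; _, _]
    ext i j; fin_cases i <;> fin_cases j <;> simp [add_add_add_comm])
  map_smul' c x := Subtype.ext (by
    change !![_, _; _, _] = c • !![_, _; _, _]
    ext i j; fin_cases i <;> fin_cases j <;> simp)

/-- The odd element `!![0, 0; z - z^*, 0]`. -/
def lowerElt : R →ₗ[F] SuperOf σ where
  toFun z := ⟨!![0, 0; z - σ.toLin z, 0], by simp [superSubmodule, σ.invol']⟩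
  map_add' x y := Subtype.ext (by
    change !![_, _; _, _] = !![_, _; _, _] + !![_, _; _, _]
    ext i j; fin_cases i <;> fin_cases j <;> simp [add_sub_add_comm])
  map_smul' c x := Subtype.ext (by
    change !![_, _; _, _] = c • !![_, _; _, _]
    ext i j; fin_cases i <;> fin_cases j <;> simp [smul_sub])

theorem val_evenElt (x : R) : val σ (evenElt σ x) = !![x, 0; 0, -σ.toLin x] := rfl

theorem val_upperElt (y : R) : val σ (upperElt σ y) = !![0, y + σ.toLin y; 0, 0] := rfl

theorem val_lowerElt (z : R) : val σ (lowerElt σ z) = !![0, 0; z - σ.toLin z, 0] := rfl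

theorem evenElt_mem (x : R) : evenElt σ x ∈ even σ := ⟨rfl, rfl⟩

theorem upperElt_mem (y : R) : upperElt σ y ∈ odd σ := ⟨rfl, rfl⟩

theorem lowerElt_mem (z : R) : lowerElt σ z ∈ odd σ := ⟨rfl, rfl⟩

theorem evenElt_mul_evenElt (x y : R) :
    evenElt σ x * evenElt σ y = evenElt σ (x * y - y * x) := val_injective σ (by
  ext i j; fin_cases i <;> fin_cases j <;>
    simp [val_mul, val_evenElt, superBracket, evenPart, oddPart, σ.map_mul', sub_eq_add_neg, add_comm])

theorem upperElt_mul_evenElt (y x : R) :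
    upperElt σ y * evenElt σ x = -upperElt σ (x * (y + σ.toLin y)) := val_injective σ (by
  ext i j; fin_cases i <;> fin_cases j <;>
    simp [val_mul, val_evenElt, val_upperElt, superBracket, evenPart, oddPart, σ.map_mul',
      σ.invol', add_comm, sub_eq_add_neg])

theorem upperElt_mul_upperElt (y z : R) :
    upperElt σ y * upperElt σ z = 0 := val_injective σ (by
  ext i j; fin_cases i <;> fin_cases j <;>
    simp [val_mul, val_upperElt, superBracket, evenPart, oddPart])

theorem upperElt_mul_lowerElt (y z : R) :
    upperElt σ y * lowerElt σ z = evenElt σ ((y + σ.toLin y) * (z - σ.toLin z)) :=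
  val_injective σ (by
  ext i j; fin_cases i <;> fin_cases j <;>
    simp [val_mul, val_evenElt, val_upperElt, val_lowerElt, superBracket, evenPart, oddPart,
      σ.map_mul', σ.invol']
  noncomm_ring)

theorem evenElt_mul_upperElt (x y : R) :
    evenElt σ x * upperElt σ y = upperElt σ (x * (y + σ.toLin y)) := val_injective σ (by
  ext i j; fin_cases i <;> fin_cases j <;>
    simp [val_mul, val_evenElt, val_upperElt, superBracket, evenPart, oddPart, σ.map_mul',
      σ.invol', add_comm, sub_eq_add_neg])

theorem evenElt_mul_lowerElt (x z : R) :
    evenElt σ x * lowerElt σ z = -lowerElt σ ((z - σ.toLin z) * x) := val_injective σ (by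
  ext i j; fin_cases i <;> fin_cases j <;>
    simp [val_mul, val_evenElt, val_lowerElt, superBracket, evenPart, oddPart, σ.map_mul',
      σ.invol']
  noncomm_ring)

end Elements

end SuperOf

/-! ### Matrix units of `UT_t(F)` -/

section MatrixUnits

variable (F : Type*) [Field F] {t : ℕ}

/-- The matrix unit `e_{ij}` for `i ≤ j`, and `0` otherwise. -/
def utUnit (i j : Fin t) : UT F t :=
  ⟨if i ≤ j then Matrix.single i j 1 else 0, by
    split_ifs with h
    · intro a b hab
      refine Matrix.single_apply_of_ne _ _ _ _ _ ?_
      rintro ⟨rfl, rfl⟩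
      exact absurd hab (not_lt.2 h)
    · exact zero_mem _⟩

variable {F}

theorem utUnit_mul {i j k : Fin t} (hij : i ≤ j) (hjk : j ≤ k) :
    utUnit F i j * utUnit F j k = utUnit F i k :=
  Subtype.ext (by simp [utUnit, hij, hjk, hij.trans hjk])

theorem utUnit_mul_of_ne {j k : Fin t} (i l : Fin t) (h : j ≠ k) :
    utUnit F i j * utUnit F k l = 0 :=
  Subtype.ext (by
    simp only [utUnit, MulMemClass.mk_mul_mk, ZeroMemClass.coe_zero]
    split_ifs <;> simp [h])

theorem orthogonalInvolution_utUnit (i j : Fin t) :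
    (orthogonalInvolution F t).toLin (utUnit F i j) = utUnit F j.rev i.rev := by
  refine Subtype.ext ?_
  ext a b
  change (utUnit F i j).1 b.rev a.rev = (utUnit F j.rev i.rev).1 a b
  simp only [utUnit, Fin.rev_le_rev]
  split_ifs
  · simp only [Matrix.single_apply]
    refine if_congr ?_ rfl rfl
    rw [← Fin.rev_eq_iff, ← Fin.rev_eq_iff, and_comm]
  · rfl

theorem utUnit_apply_self {i j : Fin t} (h : i ≤ j) : (utUnit F i j).1 i j = 1 := by
  simp [utUnit, h]

end MatrixUnits

/-! ### The chain of modules over the diagonal subalgebra of `(S(2m+1), ∘)` -/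

namespace SOrth

open SuperOf

section Levels

variable {m : ℕ}

/-- The index at distance `j` above the middle index. -/
def lo (j : Fin (m + 1)) : Fin (2 * m + 1) := ⟨m - j, by omega⟩

/-- The index at distance `j` below the middle index. -/
def hi (j : Fin (m + 1)) : Fin (2 * m + 1) := ⟨m + j, by omega⟩

theorem rev_lo (j : Fin (m + 1)) : (lo j).rev = hi j := by
  ext; simp only [Fin.val_rev, lo, hi]; omega

theorem rev_hi (j : Fin (m + 1)) : (hi j).rev = lo j := by
  rw [← rev_lo, Fin.rev_rev]

theorem lo_le_hi (i j : Fin (m + 1)) : lo i ≤ hi j := by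
  simp only [Fin.le_def, lo, hi]; omega

theorem lo_succ_le (j : Fin m) : lo j.succ ≤ lo j.castSucc := by
  simp only [Fin.le_def, lo, Fin.val_succ, Fin.val_castSucc]; omega

theorem lo_injective : Function.Injective (lo (m := m)) := by
  intro i j h; ext; simp only [lo, Fin.mk.injEq] at h; omega

theorem hi_injective : Function.Injective (hi (m := m)) := by
  intro i j h; ext; simp only [hi, Fin.mk.injEq] at h; omega

theorem lo_succ_ne_hi (i : Fin m) (j : Fin (m + 1)) : lo i.succ ≠ hi j := by
  simp only [ne_eq, lo, hi, Fin.mk.injEq, Fin.val_succ]; omega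

theorem lo_ne_hi_succ (i : Fin (m + 1)) (j : Fin m) : lo i ≠ hi j.succ := by
  simp only [ne_eq, lo, hi, Fin.mk.injEq, Fin.val_succ]; omega

end Levels

/-! ### Action of diagonal elements and jumps on the units of each level -/

section Vectors

variable (F : Type*) [Field F] {m : ℕ}

/-- The symmetric unit `e_{lo j, hi j}`, regarded as an odd element. -/
def oddUnit (j : Fin (m + 1)) : SOrth F (2 * m + 1) :=
  upperElt _ (utUnit F (lo j) (hi j))

/-- The symmetric unit `e_{lo j, hi j}`, regarded as an even element. -/
def evenUnit (j : Fin (m + 1)) : SOrth F (2 * m + 1) :=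
  evenElt _ (utUnit F (lo j) (hi j))

/-- The even element joining two consecutive levels. -/
def jump (j : Fin m) : SOrth F (2 * m + 1) :=
  evenElt _ (utUnit F (lo j.succ) (lo j.castSucc))

/-- The diagonal even elements: at each level `j ≤ m` the one which acts on `oddUnit j` only, and
at each level `j + 1 ≤ m` one which acts on `evenUnit (j + 1)` only. -/
def evenDiag : Fin (m + 1) ⊕ Fin m → SOrth F (2 * m + 1)
  | Sum.inl j => evenElt _ (utUnit F (lo j) (lo j) + utUnit F (hi j) (hi j))
  | Sum.inr j => evenElt _ (utUnit F (hi j.succ) (hi j.succ))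

/-- The diagonal odd elements: at each level `j + 1 ≤ m` one which maps `oddUnit (j + 1)` to
`evenUnit (j + 1)`, and one acting in the opposite direction. -/
def oddDiag : Fin m ⊕ Fin m → SOrth F (2 * m + 1)
  | Sum.inl j => lowerElt _ (utUnit F (lo j.succ) (lo j.succ))
  | Sum.inr j => upperElt _ (utUnit F (lo j.succ) (lo j.succ))

theorem jump_mem (j : Fin m) : jump F j ∈ even (orthogonalInvolution F (2 * m + 1)) :=
  evenElt_mem _ _

theorem evenDiag_mem (τ : Fin (m + 1) ⊕ Fin m) :
    evenDiag F τ ∈ even (orthogonalInvolution F (2 * m + 1)) := by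
  cases τ <;> exact evenElt_mem _ _

theorem oddDiag_mem (τ : Fin m ⊕ Fin m) :
    oddDiag F τ ∈ odd (orthogonalInvolution F (2 * m + 1)) := by
  cases τ
  · exact lowerElt_mem _ _
  · exact upperElt_mem _ _

theorem oddUnit_mem (j : Fin (m + 1)) :
    oddUnit F j ∈ odd (orthogonalInvolution F (2 * m + 1)) := upperElt_mem _ _

/-- The unit is symmetric, so `upperElt` doubles it and its nonzero entry is 2. -/
theorem oddUnit_ne_zero [CharZero F] (j : Fin (m + 1)) : oddUnit F j ≠ 0 := by
  intro h
  have h1 := congrArg (fun M => M 0 1) (congrArg (val _) h)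
  simp only [oddUnit, val_upperElt, orthogonalInvolution_utUnit, rev_lo, rev_hi] at h1
  have h2 := congrArg (fun X : UT F (2 * m + 1) => X.1 (lo j) (hi j)) h1
  have h3 := utUnit_apply_self (F := F) (lo_le_hi j j)
  change (utUnit F (lo j) (hi j)).1 (lo j) (hi j) +
    (utUnit F (lo j) (hi j)).1 (lo j) (hi j) = 0 at h2
  rw [h3] at h2
  norm_num at h2

theorem utUnit_mul_utUnit_right (i k : Fin (m + 1)) :
    utUnit F (lo k) (hi k) * utUnit F (hi i) (hi i) =
      if i = k then utUnit F (lo k) (hi k) else 0 := by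
  split_ifs with h
  · subst h; exact utUnit_mul (lo_le_hi _ _) le_rfl
  · exact utUnit_mul_of_ne _ _ fun h' => h (hi_injective h').symm

theorem utUnit_mul_utUnit_left (i k : Fin (m + 1)) :
    utUnit F (lo i) (lo i) * utUnit F (lo k) (hi k) =
      if i = k then utUnit F (lo k) (hi k) else 0 := by
  split_ifs with h
  · subst h; exact utUnit_mul le_rfl (lo_le_hi _ _)
  · exact utUnit_mul_of_ne _ _ fun h' => h (lo_injective h')

/-- On upper odd elements an even element acts by left multiplication followed by symmetrization, so
only the part of the diagonal at `lo j.succ` matters; the parts at `hi` indices annihilate the unit.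
-/
theorem oddUnit_succ_mul_evenDiag (j : Fin m) (τ : Fin (m + 1) ⊕ Fin m) :
    oddUnit F j.succ * evenDiag F τ =
      (if τ = Sum.inl j.succ then (-2 : F) else 0) • oddUnit F j.succ := by
  have hh : ∀ i : Fin (m + 1), utUnit F (hi i) (hi i) * utUnit F (lo j.succ) (hi j.succ) = 0 :=
    fun i => utUnit_mul_of_ne _ _ (lo_succ_ne_hi j i).symm
  cases τ <;>
    simp only [oddUnit, evenDiag, upperElt_mul_evenElt, orthogonalInvolution_utUnit, rev_lo,
      rev_hi, mul_add, add_mul, utUnit_mul_utUnit_left, hh, Sum.inl.injEq, reduceCtorEq]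
  · split_ifs
    · simp only [map_add, map_zero]; module
    · simp
  · simp

/-- At level 0 the indices `lo` and `hi` coincide, so both summands of the diagonal element
contribute and the scalar doubles to -4. -/
theorem oddUnit_zero_mul_evenDiag (τ : Fin (m + 1) ⊕ Fin m) :
    oddUnit F (0 : Fin (m + 1)) * evenDiag F τ =
      (if τ = Sum.inl 0 then (-4 : F) else 0) • oddUnit F (0 : Fin (m + 1)) := by
  have h0 : hi (0 : Fin (m + 1)) = lo 0 := by ext; simp [hi, lo]
  have hh : ∀ i : Fin (m + 1), utUnit F (hi i) (hi i) * utUnit F (lo 0) (hi 0) =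
      if i = 0 then utUnit F (lo 0) (hi 0) else 0 := fun i => by
    split_ifs with h
    · subst h; rw [h0]; exact utUnit_mul le_rfl le_rfl
    · exact utUnit_mul_of_ne _ _ fun h' => h (hi_injective (h'.trans h0.symm))
  cases τ <;>
    simp only [oddUnit, evenDiag, upperElt_mul_evenElt, orthogonalInvolution_utUnit, rev_lo,
      rev_hi, mul_add, add_mul, utUnit_mul_utUnit_left, hh, Sum.inl.injEq, reduceCtorEq]
  · split_ifs
    · simp only [map_add]; module
    · simp
  · simp [Fin.succ_ne_zero]

/-- Here the action is a commutator: the two summands of a diagonal element of type `Sum.inl`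
cancel, while the single unit at `hi j.succ` survives. This separates the two units of a level. -/
theorem evenUnit_succ_mul_evenDiag (j : Fin m) (τ : Fin (m + 1) ⊕ Fin m) :
    evenUnit F j.succ * evenDiag F τ =
      (if τ = Sum.inr j then (1 : F) else 0) • evenUnit F j.succ := by
  have hh : ∀ i : Fin (m + 1), utUnit F (hi i) (hi i) * utUnit F (lo j.succ) (hi j.succ) = 0 :=
    fun i => utUnit_mul_of_ne _ _ (lo_succ_ne_hi j i).symm
  have hl : ∀ i : Fin (m + 1), utUnit F (lo j.succ) (hi j.succ) * utUnit F (lo i) (lo i) = 0 :=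
    fun i => utUnit_mul_of_ne _ _ (lo_ne_hi_succ i j).symm
  cases τ <;>
    simp only [evenUnit, evenDiag, evenElt_mul_evenElt, mul_add, add_mul, hh, hl,
      utUnit_mul_utUnit_left, utUnit_mul_utUnit_right, Sum.inr.injEq, reduceCtorEq, Fin.succ_inj]
  · simp
  · split_ifs <;> simp

theorem oddUnit_succ_mul_oddDiag (j : Fin m) (τ : Fin m ⊕ Fin m) :
    oddUnit F j.succ * oddDiag F τ =
      (if τ = Sum.inl j then (-2 : F) else 0) • evenUnit F j.succ := by
  have hl : ∀ i : Fin (m + 1), utUnit F (lo j.succ) (hi j.succ) * utUnit F (lo i) (lo i) = 0 :=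
    fun i => utUnit_mul_of_ne _ _ (lo_ne_hi_succ i j).symm
  cases τ <;>
    simp only [oddUnit, evenUnit, oddDiag, upperElt_mul_lowerElt, upperElt_mul_upperElt,
      orthogonalInvolution_utUnit, rev_lo, rev_hi, mul_sub, add_mul, hl,
      utUnit_mul_utUnit_right, Sum.inl.injEq, reduceCtorEq, Fin.succ_inj]
  · split_ifs
    · simp only [map_add, map_sub, map_zero]; module
    · simp
  · simp

theorem evenUnit_succ_mul_oddDiag (j : Fin m) (τ : Fin m ⊕ Fin m) :
    evenUnit F j.succ * oddDiag F τ =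
      (if τ = Sum.inr j then (1 : F) else 0) • oddUnit F j.succ := by
  have hh : ∀ i : Fin (m + 1), utUnit F (hi i) (hi i) * utUnit F (lo j.succ) (hi j.succ) = 0 :=
    fun i => utUnit_mul_of_ne _ _ (lo_succ_ne_hi j i).symm
  have hl : ∀ i : Fin (m + 1), utUnit F (lo j.succ) (hi j.succ) * utUnit F (lo i) (lo i) = 0 :=
    fun i => utUnit_mul_of_ne _ _ (lo_ne_hi_succ i j).symm
  -- The lower block is skew and the unit is symmetric, so lower diagonal elements annihilate the
  -- even unit.
  have hs : lowerElt (orthogonalInvolution F (2 * m + 1)) (utUnit F (lo j.succ) (hi j.succ)) = 0 :=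
    val_injective _ (by
      rw [val_lowerElt, orthogonalInvolution_utUnit, rev_lo, rev_hi, sub_self, map_zero]
      ext i j; fin_cases i <;> fin_cases j <;> rfl)
  cases τ <;>
    simp only [oddUnit, evenUnit, oddDiag, evenElt_mul_lowerElt, evenElt_mul_upperElt,
      orthogonalInvolution_utUnit, rev_lo, sub_mul, mul_add, hh, hl,
      utUnit_mul_utUnit_left, utUnit_mul_utUnit_right, Sum.inr.injEq, reduceCtorEq, Fin.succ_inj]
  · rw [if_neg not_false, zero_smul]
    split_ifs <;> simp [hs]
  · split_ifs <;> simp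

/-- One jump moves only one of the two indices and yields the symmetrization of a mixed unit; the
second moves the other index. The two minus signs cancel. -/
theorem oddUnit_mul_jump_mul_jump (j : Fin m) :
    oddUnit F j.castSucc * jump F j * jump F j = (2 : F) • oddUnit F j.succ := by
  have h1 : utUnit F (lo j.succ) (lo j.castSucc) * utUnit F (lo j.castSucc) (hi j.castSucc) =
      utUnit F (lo j.succ) (hi j.castSucc) := utUnit_mul (lo_succ_le j) (lo_le_hi _ _)
  have h2 : utUnit F (lo j.succ) (lo j.castSucc) * utUnit F (lo j.succ) (hi j.castSucc) = 0 :=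
    utUnit_mul_of_ne _ _ fun h => (Fin.castSucc_lt_succ (i := j)).ne (lo_injective h)
  have h3 : utUnit F (lo j.succ) (lo j.castSucc) * utUnit F (lo j.castSucc) (hi j.succ) =
      utUnit F (lo j.succ) (hi j.succ) := utUnit_mul (lo_succ_le j) (lo_le_hi _ _)
  simp only [oddUnit, jump, upperElt_mul_evenElt, orthogonalInvolution_utUnit, rev_lo, rev_hi,
    mul_add, h1, map_add, h2, h3, neg_mul, add_mul, zero_add]
  module

end Vectors

end SOrth

/-! ### Products along lists -/

section FoldlMul

variable {F A α : Type*} [Field F] [NonUnitalNonAssocRing A] [Module F A] [IsScalarTower F A A]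

theorem foldl_mul_smul (f : α → A) (c : F) (l : List α) (v : A) :
    l.foldl (fun v b => v * f b) (c • v) = c • l.foldl (fun v b => v * f b) v := by
  induction l generalizing v with
  | nil => rfl
  | cons b l ih => rw [List.foldl_cons, smul_mul_assoc, ih, List.foldl_cons]

theorem foldl_mul_flatMap_finRange (f : α → A) {n : ℕ} (seg : Fin n → List α) (V : A) (a : Fin n → F)
    (h : ∀ i, (seg i).foldl (fun v b => v * f b) V = a i • V) :
    ((List.finRange n).flatMap seg).foldl (fun v b => v * f b) V = (∏ i, a i) • V := by
  rw [Fin.prod_univ_def]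
  induction List.finRange n with
  | nil => simp
  | cons i l ih =>
    rw [List.flatMap_cons, List.foldl_append, h, foldl_mul_smul, ih, smul_smul, List.map_cons,
      List.prod_cons]

theorem foldl_mul_flatMap_chain (f : α → A) {n : ℕ} (seg : Fin n → List α) (V : Fin (n + 1) → A)
    (a : Fin n → F)
    (h : ∀ i, (seg i).foldl (fun v b => v * f b) (V i.castSucc) = a i • V i.succ) :
    ((List.finRange n).flatMap seg).foldl (fun v b => v * f b) (V 0) =
      (∏ i, a i) • V (Fin.last n) := by
  induction n with
  | zero => simp
  | succ n ih =>
    have hi := ih (fun i => seg i.castSucc) (fun i => V i.castSucc) (fun i => a i.castSucc)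
      (fun i => h i.castSucc)
    rw [List.finRange_succ_last, List.flatMap_append, List.foldl_append, List.flatMap_map]
    rw [Fin.castSucc_zero] at hi
    rw [hi, foldl_mul_smul, List.flatMap_singleton, h, smul_smul, Fin.prod_univ_castSucc,
      Fin.succ_last]

end FoldlMul

/-! ### The template word -/

namespace SOrth

open SuperOf

/-- The names of the even diagonal elements. -/
abbrev EvenType (m : ℕ) := Fin (m + 1) ⊕ Fin m

/-- The names of the odd diagonal elements. -/
abbrev OddType (m : ℕ) := Fin m ⊕ Fin m

/-- The even letters of the template word: two jumps for each level, `r` auxiliary letters, and `q`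
letters for each even diagonal element. -/
abbrev EvenLetter (m q r : ℕ) := (Fin m × Fin 2) ⊕ (Fin r ⊕ (EvenType m × Fin q))

/-- The odd letters of the template word: the initial letter and `q` letters for each odd diagonal
element. -/
abbrev OddLetter (m q : ℕ) := Unit ⊕ (OddType m × Fin q)

section Template

variable {m q r : ℕ}

/-- The letter for the `c`-th occurrence of an even diagonal element. -/
abbrev evenSlot (τ : EvenType m) (c : Fin q) : EvenLetter m q r ⊕ OddLetter m q :=
  Sum.inl (Sum.inr (Sum.inr (τ, c)))

/-- The letter for the `c`-th occurrence of an odd diagonal element. -/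
abbrev oddSlot (τ : OddType m) (c : Fin q) : EvenLetter m q r ⊕ OddLetter m q :=
  Sum.inr (Sum.inr (τ, c))

/-- Four letters leading from `oddUnit (j + 1)` through `evenUnit (j + 1)` and back. -/
def cycleLetters (j : Fin m) (c : Fin q) : List (EvenLetter m q r ⊕ OddLetter m q) :=
  [evenSlot (Sum.inl j.succ) c, oddSlot (Sum.inl j) c, evenSlot (Sum.inr j) c,
    oddSlot (Sum.inr j) c]

/-- Two jumps from level `j` to level `j + 1`, followed by `q` cycles there. -/
def levelLetters (j : Fin m) : List (EvenLetter m q r ⊕ OddLetter m q) :=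
  Sum.inl (Sum.inl (j, 0)) :: Sum.inl (Sum.inl (j, 1)) :: (List.finRange q).flatMap (cycleLetters j)

variable (m q r) in
/-- All letters of the template word but the first one. -/
def templateTail : List (EvenLetter m q r ⊕ OddLetter m q) :=
  (List.finRange r).flatMap (fun i => [Sum.inl (Sum.inr (Sum.inl i))]) ++
    ((List.finRange q).flatMap (fun c => [evenSlot (Sum.inl 0) c]) ++
      (List.finRange m).flatMap levelLetters)

/-- The word is multilinear: every letter occurs, and the length equals the number of letters, so
none is repeated. -/
theorem coe_templateTail :
    ((Sum.inr (Sum.inl ()) :: templateTail m q r : List (EvenLetter m q r ⊕ OddLetter m q)) :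
      Multiset (EvenLetter m q r ⊕ OddLetter m q)) = Finset.univ.val := by
  symm
  refine Multiset.eq_of_le_of_card_le ((Multiset.le_iff_subset Finset.univ.nodup).2 ?_) ?_
  · rintro ((⟨j, e⟩ | i | ⟨j | j, c⟩) | u | ⟨j | j, c⟩) -
    · fin_cases e <;> simp [templateTail, levelLetters, cycleLetters]
    · simp [templateTail]
    · induction j using Fin.cases <;> simp [templateTail, levelLetters, cycleLetters]
    · simp [templateTail, levelLetters, cycleLetters]
    · simp
    · simp [templateTail, levelLetters, cycleLetters]
    · simp [templateTail, levelLetters, cycleLetters]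
  · simp only [Multiset.coe_card, List.length_cons, templateTail, List.length_append,
      List.length_flatMap, levelLetters, cycleLetters, List.length_nil, List.map_const',
      List.length_finRange, List.sum_replicate, smul_eq_mul]
    rw [← Finset.card_def, Finset.card_univ]
    simp only [Fintype.card_sum, Fintype.card_prod, Fintype.card_fin, Fintype.card_unit]
    apply le_of_eq
    ring

variable (F : Type*) [Field F]

/-- Evaluation of the even letters, where the slots are filled according to `s`. -/
def evenEval (s : EvenType m × Fin q → EvenType m) :
    EvenLetter m q r → even (orthogonalInvolution F (2 * m + 1))
  | Sum.inl (j, _) => ⟨jump F j, jump_mem F j⟩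
  | Sum.inr (Sum.inl _) => ⟨evenDiag F (Sum.inl 0), evenDiag_mem F _⟩
  | Sum.inr (Sum.inr x) => ⟨evenDiag F (s x), evenDiag_mem F _⟩

/-- Evaluation of the odd letters, where the slots are filled according to `u`. -/
def oddEval (u : OddType m × Fin q → OddType m) :
    OddLetter m q → odd (orthogonalInvolution F (2 * m + 1))
  | Sum.inl _ => ⟨oddUnit F 0, oddUnit_mem F _⟩
  | Sum.inr x => ⟨oddDiag F (u x), oddDiag_mem F _⟩

/-- Evaluation of all letters. -/
def letterEval (s : EvenType m × Fin q → EvenType m) (u : OddType m × Fin q → OddType m) :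
    EvenLetter m q r ⊕ OddLetter m q → SOrth F (2 * m + 1) :=
  Sum.elim (fun x => (evenEval F s x).1) (fun y => (oddEval F u y).1)

/-- The scalar produced by one cycle. -/
def cycleCoeff (s : EvenType m × Fin q → EvenType m) (u : OddType m × Fin q → OddType m)
    (j : Fin m) (c : Fin q) : F :=
  (if s (Sum.inl j.succ, c) = Sum.inl j.succ then (-2 : F) else 0) *
  ((if u (Sum.inl j, c) = Sum.inl j then (-2 : F) else 0) *
  ((if s (Sum.inr j, c) = Sum.inr j then (1 : F) else 0) *
  (if u (Sum.inr j, c) = Sum.inr j then (1 : F) else 0)))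

theorem foldl_cycleLetters (s : EvenType m × Fin q → EvenType m)
    (u : OddType m × Fin q → OddType m) (j : Fin m) (c : Fin q) :
    (cycleLetters j c).foldl (fun v b => v * letterEval (r := r) F s u b) (oddUnit F j.succ) =
      cycleCoeff F s u j c • oddUnit F j.succ := by
  change oddUnit F j.succ * evenDiag F (s (Sum.inl j.succ, c)) * oddDiag F (u (Sum.inl j, c)) *
    evenDiag F (s (Sum.inr j, c)) * oddDiag F (u (Sum.inr j, c)) = _
  simp only [oddUnit_succ_mul_evenDiag, oddUnit_succ_mul_oddDiag, evenUnit_succ_mul_evenDiag,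
    evenUnit_succ_mul_oddDiag, smul_mul_assoc, smul_smul, cycleCoeff, mul_assoc]

theorem foldl_levelLetters (s : EvenType m × Fin q → EvenType m)
    (u : OddType m × Fin q → OddType m) (j : Fin m) :
    (levelLetters j).foldl (fun v b => v * letterEval (r := r) F s u b) (oddUnit F j.castSucc) =
      (2 * ∏ c, cycleCoeff F s u j c) • oddUnit F j.succ := by
  change ((List.finRange q).flatMap (cycleLetters j)).foldl _
    (oddUnit F j.castSucc * jump F j * jump F j) = _
  rw [oddUnit_mul_jump_mul_jump, foldl_mul_smul,
    foldl_mul_flatMap_finRange _ _ _ _ (foldl_cycleLetters F s u j), smul_smul]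

/-- The scalar produced by the template word. -/
def templateCoeff (r : ℕ) (s : EvenType m × Fin q → EvenType m)
    (u : OddType m × Fin q → OddType m) : F :=
  (∏ _i : Fin r, (-4 : F)) *
    ((∏ c, if s (Sum.inl 0, c) = Sum.inl 0 then (-4 : F) else 0) *
      ∏ j, (2 * ∏ c, cycleCoeff F s u j c))

theorem foldl_templateTail (s : EvenType m × Fin q → EvenType m)
    (u : OddType m × Fin q → OddType m) :
    (templateTail m q r).foldl (fun v b => v * letterEval F s u b)
      (letterEval (r := r) F s u (Sum.inr (Sum.inl ()))) =
      templateCoeff F r s u • oddUnit F (Fin.last m) := by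
  change (templateTail m q r).foldl _ (oddUnit F 0) = _
  have h0 : oddUnit F (0 : Fin (m + 1)) * evenDiag F (Sum.inl 0) =
      (-4 : F) • oddUnit F (0 : Fin (m + 1)) := by
    rw [oddUnit_zero_mul_evenDiag, if_pos rfl]
  have h1 := foldl_mul_flatMap_finRange (letterEval (r := r) F s u)
    (fun i : Fin r => [Sum.inl (Sum.inr (Sum.inl i))]) (oddUnit F 0) (fun _ => (-4 : F))
    fun _ => h0
  have h2 := foldl_mul_flatMap_finRange (letterEval (r := r) F s u)
    (fun c => [evenSlot (Sum.inl 0) c]) (oddUnit F 0)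
    (fun c => if s (Sum.inl 0, c) = Sum.inl 0 then (-4 : F) else 0)
    fun c => oddUnit_zero_mul_evenDiag F _
  rw [templateTail, List.foldl_append, List.foldl_append, h1, foldl_mul_smul, foldl_mul_smul, h2,
    foldl_mul_smul, foldl_mul_flatMap_chain _ _ (oddUnit F) _ (foldl_levelLetters F s u),
    smul_smul, smul_smul, templateCoeff, mul_assoc]

theorem templateCoeff_ne_zero_iff [CharZero F] (s : EvenType m × Fin q → EvenType m)
    (u : OddType m × Fin q → OddType m) :
    templateCoeff F r s u ≠ 0 ↔ s = Prod.fst ∧ u = Prod.fst := by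
  -- The even slots of type `Sum.inl` are split into level 0, tested before the first jump, and the
  -- higher levels, tested inside the cycles.
  simp only [templateCoeff, cycleCoeff, ne_eq, mul_eq_zero, Finset.prod_eq_zero_iff, not_or,
    not_exists, not_and, Finset.mem_univ, true_imp_iff, funext_iff, Prod.forall, Sum.forall,
    Fin.forall_fin_succ (P := fun j => ∀ c, s (Sum.inl j, c) = Sum.inl j)]
  simp [forall_and]
  tauto

/-- The permutation of the letters which permutes the slots and fixes all other letters. -/
def slotPerm (g : Equiv.Perm (EvenType m × Fin q)) (h : Equiv.Perm (OddType m × Fin q)) :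
    Equiv.Perm (EvenLetter m q r ⊕ OddLetter m q) :=
  Equiv.sumCongr (Equiv.sumCongr (Equiv.refl _) (Equiv.sumCongr (Equiv.refl _) g))
    (Equiv.sumCongr (Equiv.refl _) h)

/-- Renaming slots in the word amounts to precomposing the fillings, so every renamed word is
evaluated by the template formula. -/
theorem letterEval_slotPerm (s : EvenType m × Fin q → EvenType m)
    (u : OddType m × Fin q → OddType m) (g : Equiv.Perm (EvenType m × Fin q))
    (h : Equiv.Perm (OddType m × Fin q)) (x : EvenLetter m q r ⊕ OddLetter m q) :
    letterEval F s u (slotPerm g h x) = letterEval F (s ∘ g) (u ∘ h) x := by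
  rcases x with (_ | _ | _) | _ | _ <;> rfl

end Template

/-! ### Dual families of words and evaluations -/

theorem map_val_univ_of_equiv_fin {α : Type*} [Fintype α] {k : ℕ} (e : α ≃ Fin k) :
    Multiset.map (fun x => (e x : ℕ)) Finset.univ.val = Multiset.range k := by
  refine (Multiset.Nodup.ext (Finset.univ.nodup.map (Fin.val_injective.comp e.injective))
    (Multiset.nodup_range k)).2 fun n => ?_
  simp only [Multiset.mem_map, Finset.mem_val, Finset.mem_univ, true_and, Multiset.mem_range]
  exact ⟨fun ⟨x, hx⟩ => hx ▸ (e x).2, fun hn => ⟨e.symm ⟨n, hn⟩, by simp⟩⟩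

theorem card_mul_card_le_partialCodim (F : Type*) [Field F] [CharZero F] (m q r : ℕ) :
    Nat.card (EquifiberedMaps (EvenType m) q) * Nat.card (EquifiberedMaps (OddType m) q) ≤
      partialCodim F (even (orthogonalInvolution F (2 * m + 1)))
        (odd (orthogonalInvolution F (2 * m + 1)))
        (m * 2 + (r + (2 * m + 1) * q)) (1 + 2 * m * q) := by
  classical
  have hcE : Fintype.card (EvenLetter m q r) = m * 2 + (r + (2 * m + 1) * q) := by
    simp only [Fintype.card_sum, Fintype.card_prod, Fintype.card_fin]; ring
  have hcO : Fintype.card (OddLetter m q) = 1 + 2 * m * q := by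
    simp only [Fintype.card_sum, Fintype.card_prod, Fintype.card_fin, Fintype.card_unit]; ring
  generalize m * 2 + (r + (2 * m + 1) * q) = k at hcE
  generalize 1 + 2 * m * q = l at hcO
  let eE := Fintype.equivFinOfCardEq hcE
  let eO := Fintype.equivFinOfCardEq hcO
  let name : EvenLetter m q r ⊕ OddLetter m q → ℕ ⊕ ℕ :=
    Sum.map (fun x => (eE x : ℕ)) (fun y => (eO y : ℕ))
  have hname : Multiset.map name Finset.univ.val = multilinearLetters k l := by
    rw [multilinearLetters, ← map_val_univ_of_equiv_fin eE, ← map_val_univ_of_equiv_fin eO,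
      ← Finset.univ_disjSum_univ, Finset.val_disjSum,
      Multiset.disjSum, Multiset.map_add]
    simp only [Multiset.map_map]
    rfl
  rw [Nat.card_eq_fintype_card, Nat.card_eq_fintype_card, ← Fintype.card_prod]
  -- Each filling `s` is represented by a permutation with `Prod.fst ∘ g s = s`. Word `j` is renamed
  -- by the inverses, so evaluation `i` fits it exactly when `s_i ∘ (g s_j)⁻¹ = Prod.fst`, that is
  -- `s_i = s_j`, and likewise for the odd slots.
  choose g hg using fun s : EquifiberedMaps (EvenType m) q => s.2
  choose h hh using fun s : EquifiberedMaps (OddType m) q => s.2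
  let ρ := fun i : EquifiberedMaps (EvenType m) q × EquifiberedMaps (OddType m) q =>
     slotPerm (r := r) (g i.1).symm (h i.2).symm
  -- The value 0 beyond the first `k` letters is never used by the words `w`.
  let a := fun (i : EquifiberedMaps (EvenType m) q × EquifiberedMaps (OddType m) q) (n : ℕ) =>
    if hn : n < k then evenEval F (r := r) i.1.1 (eE.symm ⟨n, hn⟩) else 0
  let b := fun (i : EquifiberedMaps (EvenType m) q × EquifiberedMaps (OddType m) q) (n : ℕ) =>
    if hn : n < l then oddEval F i.2.1 (eO.symm ⟨n, hn⟩) else 0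
  let w := fun i => leftNormedWord (name (ρ i (Sum.inr (Sum.inl ()))))
    ((templateTail m q r).map fun x => name (ρ i x))
  have heval : ∀ i j, FreeMagma.lift (Sum.elim (fun n => (a i n : SOrth F (2 * m + 1)))
      (fun n => (b i n : SOrth F (2 * m + 1)))) (w j) =
        templateCoeff F r (i.1.1 ∘ (g j.1).symm) (i.2.1 ∘ (h j.2).symm) • oddUnit F (Fin.last m) := by
    intro i j
    rw [lift_leftNormedWord, List.foldl_map, ← foldl_templateTail]
    have hx : ∀ x, Sum.elim (fun n => (a i n : SOrth F (2 * m + 1)))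
        (fun n => (b i n : SOrth F (2 * m + 1))) (name (ρ j x)) =
          letterEval F (i.1.1 ∘ (g j.1).symm) (i.2.1 ∘ (h j.2).symm) x := by
      intro x
      rw [← letterEval_slotPerm]
      change _ = letterEval F i.1.1 i.2.1 (ρ j x)
      rcases ρ j x with x | x <;> simp [name, a, b, letterEval]
    simp only [hx]
  have hzero : ∀ i j, FreeMagma.lift (Sum.elim (fun n => (a i n : SOrth F (2 * m + 1)))
      (fun n => (b i n : SOrth F (2 * m + 1)))) (w j) ≠ 0 ↔ i = j := by
    intro i j
    rw [heval, smul_ne_zero_iff_left (oddUnit_ne_zero F _), templateCoeff_ne_zero_iff,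
      Equiv.comp_symm_eq, Equiv.comp_symm_eq, Prod.ext_iff, Subtype.ext_iff, Subtype.ext_iff]
    exact and_congr (by rw [← hg j.1]) (by rw [← hh j.2])
  refine card_le_partialCodim _ _ w (fun i => ?_) a b (fun i => (hzero i i).2 rfl)
    fun i j hij => not_not.1 fun hne => hij ((hzero i j).1 hne).symm
  rw [magmaLetters_leftNormedWord, ← hname, ← Multiset.map_univ_val_equiv (ρ i), Multiset.map_map,
    ← coe_templateTail]
  rfl

end SOrth

/-! ### The lower bound for the graded codimensions -/

theorem choose_mul_partialCodim_le_gradedCodim {F A : Type*} [Field F] [NonUnitalNonAssocRing A]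
    [Module F A] [IsScalarTower F A A] [SMulCommClass F A A] (A₀ A₁ : Submodule F A) (k l : ℕ) :
    (k + l).choose k * partialCodim F A₀ A₁ k l ≤ gradedCodim F A₀ A₁ (k + l) := by
  have h := Finset.single_le_sum
    (f := fun i => (k + l).choose i * partialCodim F A₀ A₁ i (k + l - i))
    (fun _ _ => Nat.zero_le _) (Finset.mem_range.2 (Nat.lt_succ_of_le (Nat.le_add_right k l)))
  rwa [Nat.add_sub_cancel_left] at h

open Nat in
-- The number of ways to place the two parities turns two multinomial bounds into one; the extra `k
-- - a` and `l - b` letters only enlarge the binomial coefficient.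
theorem factorial_add_mul_le {a b k l x y u v c : ℕ} (hk : a ≤ k) (hl : b ≤ l)
    (hx : a ! ≤ x * u) (hy : b ! ≤ y * v) (hc : (k + l).choose k * (x * y) ≤ c) :
    (a + b)! ≤ c * (u * v) := by
  have hchoose : (a + b).choose a ≤ (k + l).choose k := by
    obtain ⟨d, rfl⟩ := Nat.exists_eq_add_of_le hk
    obtain ⟨e, rfl⟩ := Nat.exists_eq_add_of_le hl
    have := choose_le_choose_add (a + b) a (d + e) d (Nat.le_add_right d e)
    rwa [show a + b + (d + e) = a + d + (b + e) by ring] at this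
  calc (a + b)! = (a + b).choose a * a ! * b ! := by
        rw [← Nat.add_choose_mul_factorial_mul_factorial, Nat.choose_symm_add]
    _ ≤ (k + l).choose k * (x * u) * (y * v) := by gcongr
    _ = (k + l).choose k * (x * y) * (u * v) := by ring
    _ ≤ c * (u * v) := by gcongr

/-! ### Words of arbitrary length -/

namespace SOrth

open SuperOf

open Nat in
theorem factorial_le_gradedCodim_mul (F : Type*) [Field F] [CharZero F] (m q r : ℕ) :
    ((4 * m + 1) * q)! ≤
      gradedCodim F (even (orthogonalInvolution F (2 * m + 1)))
        (odd (orthogonalInvolution F (2 * m + 1))) ((4 * m + 1) * q + (2 * m + 1 + r)) *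
        q ! ^ (4 * m + 1) := by
  have hE := factorial_le_card_equifiberedMaps (EvenType m) q
  have hO := factorial_le_card_equifiberedMaps (OddType m) q
  rw [show Fintype.card (EvenType m) = 2 * m + 1 by
    simp only [Fintype.card_sum, Fintype.card_fin]; ring] at hE
  rw [show Fintype.card (OddType m) = 2 * m by
    simp only [Fintype.card_sum, Fintype.card_fin]; ring] at hO
  have hc := (Nat.mul_le_mul_left _ (card_mul_card_le_partialCodim F m q r)).trans
    (choose_mul_partialCodim_le_gradedCodim _ _ _ _)
  have h := factorial_add_mul_le (by rw [← add_assoc]; exact Nat.le_add_left _ _)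
    (Nat.le_add_left _ _) hE hO hc
  rw [← pow_add, ← add_mul] at h
  rw [show 4 * m + 1 = 2 * m + 1 + 2 * m by ring,
    show (2 * m + 1 + 2 * m) * q + (2 * m + 1 + r) =
      m * 2 + (r + (2 * m + 1) * q) + (1 + 2 * m * q) by ring]
  exact h

open Nat in
theorem pow_le_gradedCodim_mul (F : Type*) [Field F] [CharZero F] (m n : ℕ)
    (hn : 6 * m + 2 ≤ n) :
    (4 * m + 1) ^ n ≤
      gradedCodim F (even (orthogonalInvolution F (2 * m + 1)))
        (odd (orthogonalInvolution F (2 * m + 1))) n *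
        ((4 * m + 1) ^ (10 * m + 3) * n ^ (8 * m + 2)) := by
  set p := 4 * m + 1 with hp
  -- The template has `q + 1` slots per type, `2m + 1` fixed letters and `r` fillers; the shift by 1
  -- matches `pow_mul_factorial_pow_le`. The assumption on `n` is `p + (2m + 1) ≤ n`, which makes
  -- the quotient positive.
  set q := (n - (2 * m + 1)) / p - 1 with hq
  set r := (n - (2 * m + 1)) % p with hr
  have hdiv := Nat.div_add_mod (n - (2 * m + 1)) p
  have hpos : 0 < (n - (2 * m + 1)) / p := Nat.div_pos (by omega) (by omega)
  have hrp : r < p := Nat.mod_lt _ (by omega)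
  have hq1 : (n - (2 * m + 1)) / p = q + 1 := by omega
  rw [hq1] at hdiv
  have hnq : n = p * (q + 1) + (2 * m + 1 + r) := by omega
  have hqn : q + 1 ≤ n := by
    rw [hnq]
    exact (Nat.le_mul_of_pos_left _ (by omega)).trans (Nat.le_add_right _ _)
  set c := gradedCodim F (even (orthogonalInvolution F (2 * m + 1)))
        (odd (orthogonalInvolution F (2 * m + 1))) n with hc
  have h1 : (p * (q + 1))! ≤ c * (q + 1)! ^ p := by
    rw [hc, hnq]; exact factorial_le_gradedCodim_mul F m (q + 1) r
  have h3 : p ^ (p * q) * q ! ^ p ≤ (c * (q + 1) ^ (p + p)) * q ! ^ p :=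
    calc p ^ (p * q) * q ! ^ p ≤ (p * (q + 1))! * (q + 1) ^ p := pow_mul_factorial_pow_le p q
      _ ≤ (c * (q + 1)! ^ p) * (q + 1) ^ p := by gcongr
      _ = _ := by rw [Nat.factorial_succ, mul_pow, pow_add]; ring
  have h4 : p ^ (p * q) ≤ c * (q + 1) ^ (p + p) :=
    Nat.le_of_mul_le_mul_right h3 (pow_pos (Nat.factorial_pos q) p)
  calc p ^ n = p ^ (p * q) * p ^ (p + (2 * m + 1 + r)) := by rw [← pow_add]; congr 1; rw [hnq]; ring
    _ ≤ (c * (q + 1) ^ (p + p)) * p ^ (10 * m + 3) := by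
      -- Since `r ≤ 4m`, the exponent `p + (2m + 1 + r)` is at most `10m + 2`.
      exact Nat.mul_le_mul h4 (Nat.pow_le_pow_right (by omega) (by omega))
    _ ≤ (c * n ^ (p + p)) * p ^ (10 * m + 3) := by gcongr
    _ = c * (p ^ (10 * m + 3) * n ^ (8 * m + 2)) := by
      rw [show p + p = 8 * m + 2 by omega]; ring

end SOrth

theorem lemma6 (F : Type*) [Field F] [CharZero F] (m : ℕ) (hm : 1 ≤ m) :
    ((4 * m + 1 : ℕ) : ℝ≥0∞) ≤
      lowerGradedExp F (A := SOrth F (2 * m + 1))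
        (SuperOf.even (orthogonalInvolution F (2 * m + 1)))
        (SuperOf.odd (orthogonalInvolution F (2 * m + 1))) := by
  refine le_liminf_rpow_one_div (C := (4 * m + 1) ^ (10 * m + 3)) (d := 8 * m + 2) (by positivity) ?_
  filter_upwards [Filter.eventually_ge_atTop (6 * m + 2)] with n hn
  exact SOrth.pow_le_gradedCodim_mul F m n hn
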